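/- A (finite) projective space is a finite set $P$ of points together with a set of lines such that any two distinct points lie on exactly one line, every line has at least three points, and (Veblen–Young) for any four distinct points $a,b,c,e$, if the lines $ab$ and $ce$ meet, then the lines $ac$ and $be$ meet. A subspace is a set of points that contains, with any two of its points, the whole line through them; the span of a set of points is the smallest subspace containing it. The space has dimension $d$ if it is spanned by $d+1$ independent points (none of them lies in the span of the others), and order $n$ if every line has exactly $n+1$ points. A hyperplane is a maximal proper subspace. For a real matrix $M$ without zero entries, $\operatorname{sign}(M)$ is the matrix of the signs of its entries. The sign rank of a $\pm1$ matrix $S$ is the minimum of $\operatorname{rank}(M)$ (over $\mathbb{R}$) over all real matrices $M$ with $\operatorname{sign}(M)=S$. A set $C$ of columns of $S$ is shattered if each of the $2^{|C|}$ sign patterns on $C$ appears in some row of $S$ restricted to $C$; the VC dimension of $S$ is the maximum size of a shattered set of columns. **Theorem.** Let $d\ge 2$ and $n\ge 3$, let $P$ be the set of points of a $d$-dimensional projective space of order $n$, and let $H$ be its set of hyperplanes. Let $A\in\{\pm1\}^{P\times H}$ be the signed point–hyperplane incidence matrix, with $A_{p,h}=1$ if $p\in h$ and $A_{p,h}=-1$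 if $p\notin h$. Then $A$ is $N\times N$, that is, $|P|=|H|=N$, with $N=\frac{n^{d+1}-1}{n-1}$; the VC dimension of $A$ is $d$; and $$\text{sign-rank}(A)\;>\;\frac{n^d-1}{n^{\frac{d-1}{2}}(n-1)}\;\ge\; N^{\frac12-\frac1{2d}}.$$ -/

import Mathlib

/-- The point-line geometry `(P, L)` is a projective space (Veblen–Young axioms). -/
structure IsProjectiveSpace (P L : Type*) [Membership P L] : Prop where
  /-- Two distinct points lie on exactly one common line. -/
  existsUnique_line : ∀ p q : P, p ≠ q → ∃! l : L, p ∈ l ∧ q ∈ l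
  /-- For distinct points `a, b, c, d`, if the lines `ab` and `cd` meet, so do `ac` and `bd`. -/
  veblen_young : ∀ (a b c d : P) (ab cd ac bd : L),
    a ≠ b → a ≠ c → a ≠ d → b ≠ c → b ≠ d → c ≠ d →
    a ∈ ab → b ∈ ab → c ∈ cd → d ∈ cd → a ∈ ac → c ∈ ac → b ∈ bd → d ∈ bd →
    (∃ p : P, p ∈ ab ∧ p ∈ cd) → ∃ q : P, q ∈ ac ∧ q ∈ bd
  /-- Every line has at least three points. -/
  three_points : ∀ l : L, ∃ a b c : P, a ≠ b ∧ a ≠ c ∧ b ≠ c ∧ a ∈ l ∧ b ∈ l ∧ c ∈ l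

namespace IsProjectiveSpace

/-- A subspace: a set of points containing, with any two distinct points, all points of every
line through them. -/
def IsSubspace {P : Type*} (L : Type*) [Membership P L] (U : Set P) : Prop :=
  ∀ p ∈ U, ∀ q ∈ U, p ≠ q → ∀ l : L, p ∈ l → q ∈ l → ∀ r : P, r ∈ l → r ∈ U

/-- The subspace spanned by a set of points. -/
def span {P : Type*} (L : Type*) [Membership P L] (X : Set P) : Set P :=
  ⋂₀ {U | IsSubspace L U ∧ X ⊆ U}

/-- A set of points is independent if none of them lies in the span of the others. -/
def Independent {P : Type*} (L : Type*) [Membership P L] (X : Set P) : Prop :=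
  ∀ x ∈ X, x ∉ span L (X \ {x})

/-- The space has dimension `d`: it has a basis (an independent spanning set) of `d + 1` points. -/
def HasDimension (P L : Type*) [Membership P L] (d : ℕ) : Prop :=
  ∃ B : Finset P, B.card = d + 1 ∧ Independent L (B : Set P) ∧ span L (B : Set P) = Set.univ

/-- The space has order `n`: every line has exactly `n + 1` points. -/
def HasOrder (P L : Type*) [Membership P L] (n : ℕ) : Prop :=
  ∀ l : L, Configuration.pointCount P l = n + 1

/-- A hyperplane: a maximal proper subspace. -/
def IsHyperplane {P : Type*} (L : Type*) [Membership P L] (U : Set P) : Prop :=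
  Maximal (fun W : Set P => IsSubspace L W ∧ W ≠ Set.univ) U

/-- The type of hyperplanes. -/
def Hyperplane (P L : Type*) [Membership P L] : Type _ :=
  {U : Set P // IsHyperplane L U}

noncomputable instance {P L : Type*} [Membership P L] [Fintype P] : Fintype (Hyperplane P L) :=
  haveI : Finite (Hyperplane P L) := inferInstanceAs (Finite {U : Set P // IsHyperplane L U})
  Fintype.ofFinite _

open Classical in
/-- The signed point-hyperplane incidence matrix; `ℤˣ = {1, -1}`. -/
noncomputable def signedIncidence (P L : Type*) [Membership P L] :
    Matrix P (Hyperplane P L) ℤˣ :=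
  Matrix.of fun p h => if p ∈ h.1 then 1 else -1

end IsProjectiveSpace

namespace SignMatrix

/-- The sign rank of a sign matrix: the least rank of a real matrix with this sign pattern. -/
noncomputable def signRank {R C : Type*} [Fintype C] (S : Matrix R C ℤˣ) : ℕ :=
  sInf {r | ∃ M : Matrix R C ℝ, (∀ i j, Real.sign (M i j) = ((S i j : ℤ) : ℝ)) ∧ M.rank = r}

/-- A set of columns is shattered if every sign pattern on it is the restriction of a row. -/
def Shattered {R C : Type*} (S : Matrix R C ℤˣ) (T : Finset C) : Prop :=
  ∀ v : C → ℤˣ, ∃ i, ∀ j ∈ T, S i j = v j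

/-- The VC dimension: the maximum size of a shattered set of columns. -/
noncomputable def vcDim {R C : Type*} (S : Matrix R C ℤˣ) : ℕ :=
  sSup {k | ∃ T : Finset C, T.card = k ∧ Shattered S T}

end SignMatrix

/-! Geometry. Joining an outside point to a subspace `U` gives a cone with n|U| + 1 points. So every
subspace is a flat, and its size `flatCard n r` = 1 + n + ⋯ + n^(r-1) determines its rank r; the
hyperplanes are the flats of rank d. Double counting (`IsFlat.ncard_isHyperplane`) shows that A is
square, that each row has D = `flatCard n d` entries +1, and that two rows share c = `flatCard n (d
- 1)` of them, with D - c = n^(d-1).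

VC dimension. In a shattered family each further hyperplane strictly lowers the rank of the
intersection, which stays nonempty, so the family has at most d members. Conversely, d of the d + 1
faces of a basis simplex are shattered.

Sign rank. By Forster's argument (`exists_forster`), vectors realising A in dimension k can be moved
into the unit ball, keeping signs, so that ∑ |⟪u, w⟫| is nearly N²/k or more. With B the 0/1
incidence matrix, G = B - D/N has the signs of A and entries of absolute value at least D/N.
Moreover GGᵀ = (D - c)I + βJ with β ≤ 0 and J the all-ones matrix, so ∑ G⟪u, w⟫ ≤ N√(D - c)
(`bilinear_le_of_gram`). Together these give D ≤ k√(D - c) = k n^((d-1)/2). Equality would force n ∣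
D², but D ≡ 1 mod n. -/

namespace IsProjectiveSpace

/-! ### Cones, flats and their cardinalities -/

variable {P L : Type*} [Membership P L]

/-- The set of points on the line through `p` and `q` (for `p ≠ q`). -/
def lineSet (L : Type*) [Membership P L] (p q : P) : Set P :=
  {x | ∃ l : L, p ∈ l ∧ q ∈ l ∧ x ∈ l}

/-- The union of `{p}` and of all lines joining `p` to a point of `U`. -/
def cone (L : Type*) [Membership P L] (p : P) (U : Set P) : Set P :=
  insert p (⋃ u ∈ U, lineSet L p u)

theorem mem_cone {p x : P} {U : Set P} :
    x ∈ cone L p U ↔ x = p ∨ ∃ u ∈ U, ∃ l : L, p ∈ l ∧ u ∈ l ∧ x ∈ l := by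
  simp [cone, lineSet]

theorem line_eq (h : IsProjectiveSpace P L) {p q : P} (hpq : p ≠ q) {l m : L}
    (hpl : p ∈ l) (hql : q ∈ l) (hpm : p ∈ m) (hqm : q ∈ m) : l = m :=
  (h.existsUnique_line p q hpq).unique ⟨hpl, hql⟩ ⟨hpm, hqm⟩

theorem exists_line (h : IsProjectiveSpace P L) {p q : P} (hpq : p ≠ q) :
    ∃ l : L, p ∈ l ∧ q ∈ l :=
  (h.existsUnique_line p q hpq).exists

theorem subset_cone (h : IsProjectiveSpace P L) {p : P} {U : Set P} (hp : p ∉ U) :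
    U ⊆ cone L p U := by
  intro u hu
  obtain ⟨l, hpl, hul⟩ := h.exists_line (p := p) (q := u) (by rintro rfl; exact hp hu)
  exact mem_cone.2 (Or.inr ⟨u, hu, l, hpl, hul, hul⟩)

theorem self_mem_cone {p : P} {U : Set P} : p ∈ cone L p U :=
  Set.mem_insert _ _

/-- This is where the Veblen–Young axiom enters. In the generic case x and y lie on different lines
pu and pv; the axiom is applied twice, once to meet line xy with line uv and once to meet line pr
with line uv. -/
theorem isSubspace_cone (h : IsProjectiveSpace P L) {p : P} {U : Set P}
    (hU : IsSubspace L U) (hp : p ∉ U) : IsSubspace L (cone L p U) := by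
  intro x hx y hy hxy l hxl hyl r hrl
  by_cases hrU : r ∈ U
  · exact h.subset_cone hp hrU
  rw [mem_cone] at hx hy ⊢
  by_cases hrp : r = p
  · exact Or.inl hrp
  right
  by_cases hxp : x = p
  · subst hxp
    obtain rfl | ⟨v, hv, m, hpm, hvm, hym⟩ := hy
    · exact absurd rfl hxy
    · obtain rfl := h.line_eq hxy hxl hyl hpm hym
      exact ⟨v, hv, l, hpm, hvm, hrl⟩
  by_cases hyp : y = p
  · subst hyp
    obtain rfl | ⟨u, hu, m, hpm, hum, hxm⟩ := hx
    · exact absurd rfl hxy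
    · obtain rfl := h.line_eq hxy hxl hyl hxm hpm
      exact ⟨u, hu, l, hpm, hum, hrl⟩
  obtain ⟨u, hu, m, hpm, hum, hxm⟩ := hx.resolve_left hxp
  obtain ⟨v, hv, m', hpm', hvm', hym'⟩ := hy.resolve_left hyp
  have hpu : p ≠ u := by rintro rfl; exact hp hu
  have hpv : p ≠ v := by rintro rfl; exact hp hv
  by_cases hmm : m = m'
  · subst hmm
    obtain rfl := h.line_eq hxy hxl hyl hxm hym'
    exact ⟨u, hu, l, hpm, hum, hrl⟩
  have huv : u ≠ v := by
    rintro rfl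
    exact hmm (h.line_eq hpu hpm hum hpm' hvm')
  have hpl : p ∉ l := by
    intro hpl
    exact hmm ((h.line_eq (Ne.symm hxp) hpm hxm hpl hxl).trans
      (h.line_eq (Ne.symm hyp) hpl hyl hpm' hym'))
  obtain ⟨k, huk, hvk⟩ := h.exists_line huv
  have hkU : ∀ z, z ∈ k → z ∈ U := hU u hu v hv huv k huk hvk
  have hvm : v ∉ m := fun hvm => hmm (h.line_eq hpv hpm hvm hpm' hvm')
  have hum' : u ∉ m' := fun hum' => hmm (h.line_eq hpu hpm hum hpm' hum')
  -- The lines xu and yv meet in p, so xy and uv meet. The coincidences x = u and y = v fall outside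
  -- the axiom and are immediate.
  obtain ⟨w, hwl, hwk⟩ : ∃ w, w ∈ l ∧ w ∈ k := by
    by_cases hxu : x = u
    · exact ⟨u, hxu ▸ hxl, huk⟩
    by_cases hyv : y = v
    · exact ⟨v, hyv ▸ hyl, hvk⟩
    exact h.veblen_young x u y v m m' l k hxu hxy (fun e => hvm (e ▸ hxm))
      (fun e => hum' (e ▸ hym')) huv hyv hxm hum hym' hvm' hxl hyl huk hvk ⟨p, hpm, hpm'⟩
  have hwU := hkU w hwk
  have hpw : p ≠ w := by rintro rfl; exact hp hwU
  have hrw : r ≠ w := by rintro rfl; exact hrU hwU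
  obtain ⟨j, hpj, hrj⟩ := h.exists_line (Ne.symm hrp)
  -- The axiom needs a point of `k` other than `w`; one of `u`, `v` always serves.
  obtain ⟨q, hqj, hqk⟩ : ∃ q, q ∈ j ∧ q ∈ k := by
    by_cases huw : u = w
    · exact h.veblen_young p v r w m' l j k hpv (Ne.symm hrp) hpw
        (by rintro rfl; exact hrU hv) (by rintro rfl; exact huv huw) hrw
        hpm' hvm' hrl hwl hpj hrj hvk hwk ⟨y, hym', hyl⟩
    · exact h.veblen_young p u r w m l j k hpu (Ne.symm hrp) hpw
        (by rintro rfl; exact hrU hu) huw hrw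
        hpm hum hrl hwl hpj hrj huk hwk ⟨x, hxm, hxl⟩
  exact ⟨q, hkU q hqk, j, hpj, hqj, hrj⟩

theorem cone_subset {p : P} {U W : Set P} (hW : IsSubspace L W) (hp : p ∉ U) (hUW : U ⊆ W)
    (hpW : p ∈ W) : cone L p U ⊆ W := by
  intro x hx
  obtain rfl | ⟨u, hu, l, hpl, hul, hxl⟩ := mem_cone.1 hx
  · exact hpW
  · exact hW p hpW u (hUW hu) (by rintro rfl; exact hp hu) l hpl hul x hxl

theorem ncard_lineSet (h : IsProjectiveSpace P L) {n : ℕ} (hn : HasOrder P L n) {p q : P}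
    (hpq : p ≠ q) : (lineSet L p q).ncard = n + 1 := by
  obtain ⟨l, hpl, hql⟩ := h.exists_line hpq
  have : lineSet L p q = {x | x ∈ l} := by
    ext x
    refine ⟨fun ⟨m, hpm, hqm, hxm⟩ => ?_, fun hx => ⟨l, hpl, hql, hx⟩⟩
    rwa [h.line_eq hpq hpm hqm hpl hql] at hxm
  rw [this]
  exact hn l

/-- Each line joining p to a point of `U` meets `U` only there, otherwise p would lie in `U`. With p
removed these lines are disjoint, and each has n points. -/
theorem ncard_cone [Finite P] (h : IsProjectiveSpace P L) {n : ℕ} (hn : HasOrder P L n)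
    {p : P} {U : Set P} (hU : IsSubspace L U) (hp : p ∉ U) :
    (cone L p U).ncard = n * U.ncard + 1 := by
  classical
  have hne : ∀ u ∈ U, p ≠ u := by rintro u hu rfl; exact hp hu
  have hcone : cone L p U = insert p (⋃ u ∈ U, lineSet L p u \ {p}) := by
    ext x
    by_cases hx : x = p <;> simp [cone, hx]
  have hU' := U.toFinite
  rw [hcone, Set.ncard_insert_of_notMem (by simp) (Set.toFinite _)]
  congr 1
  have hbi : (⋃ u ∈ U, lineSet L p u \ {p}) =
      ((hU'.toFinset.biUnion fun u => (Set.toFinite (lineSet L p u \ {p})).toFinset : Finset P)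
        : Set P) := by
    ext x; simp
  rw [hbi, Set.ncard_coe_finset, Finset.card_biUnion, Finset.sum_congr rfl (g := fun _ => n),
    Finset.sum_const, smul_eq_mul, ← Set.ncard_eq_toFinset_card U hU', mul_comm]
  · intro u hu
    have hu : u ∈ U := by simpa using hu
    obtain ⟨l, hpl, hul⟩ := h.exists_line (hne u hu)
    have hpp : p ∈ lineSet L p u := ⟨l, hpl, hul, hpl⟩
    rw [← Set.ncard_eq_toFinset_card, Set.ncard_sdiff_singleton_of_mem hpp,
      h.ncard_lineSet hn (hne u hu), Nat.add_sub_cancel]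
  · intro u hu v hv huv
    refine Finset.disjoint_left.2 ?_
    intro x hx hx'
    have hu : u ∈ U := by simpa using hu
    have hv : v ∈ U := by simpa using hv
    simp only [Set.Finite.mem_toFinset, Set.mem_sdiff, Set.mem_singleton_iff] at hx hx'
    obtain ⟨⟨l, hpl, hul, hxl⟩, hxp⟩ := hx
    obtain ⟨⟨m, hpm, hvm, hxm⟩, -⟩ := hx'
    obtain rfl := h.line_eq hxp hxl hpl hxm hpm
    exact hp (hU u hu v hv huv l hul hvm p hpl)

/-- `IsFlat L r U` means that `U` is a subspace generated by `r` independent points. -/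
inductive IsFlat (L : Type*) [Membership P L] : ℕ → Set P → Prop
  | empty : IsFlat L 0 ∅
  | join {r : ℕ} {U : Set P} {p : P} : IsFlat L r U → p ∉ U → IsFlat L (r + 1) (cone L p U)

theorem IsFlat.isSubspace (h : IsProjectiveSpace P L) {r : ℕ} {U : Set P} (hU : IsFlat L r U) :
    IsSubspace L U := by
  induction hU with
  | empty => intro p hp; exact hp.elim
  | join _ hp ih => exact h.isSubspace_cone ih hp

/-- The number of points of a flat of rank `r` in a space of order `n`. -/
def flatCard (n r : ℕ) : ℕ := ∑ i ∈ Finset.range r, n ^ i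

theorem flatCard_succ (n r : ℕ) : flatCard n (r + 1) = n * flatCard n r + 1 := by
  rw [flatCard, Finset.sum_range_succ', flatCard, Finset.mul_sum]
  simp [pow_succ']

theorem flatCard_succ' (n r : ℕ) : flatCard n (r + 1) = flatCard n r + n ^ r :=
  Finset.sum_range_succ _ _

theorem flatCard_strictMono {n : ℕ} (hn : 0 < n) : StrictMono (flatCard n) :=
  strictMono_nat_of_lt_succ fun r => by
    rw [flatCard_succ']
    exact Nat.lt_add_of_pos_right (pow_pos hn r)

theorem IsFlat.ncard [Finite P] (h : IsProjectiveSpace P L) {n : ℕ} (hn : HasOrder P L n)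
    {r : ℕ} {U : Set P} (hU : IsFlat L r U) : U.ncard = flatCard n r := by
  induction hU with
  | empty => simp [flatCard]
  | join hU hp ih => rw [h.ncard_cone hn (hU.isSubspace h) hp, ih, flatCard_succ]

/-- A flat contained in a subspace extends to a flat equal to that subspace. -/
theorem IsFlat.exists_of_subset [Finite P] (h : IsProjectiveSpace P L) {W : Set P}
    (hW : IsSubspace L W) {r : ℕ} {U : Set P} (hU : IsFlat L r U) (hUW : U ⊆ W) :
    ∃ s, r ≤ s ∧ IsFlat L s W := by
  induction hk : (W \ U).ncard using Nat.strong_induction_on generalizing r U with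
  | _ k ih =>
    by_cases hWU : W ⊆ U
    · exact ⟨r, le_rfl, hUW.antisymm hWU ▸ hU⟩
    obtain ⟨p, hpW, hpU⟩ := Set.not_subset.1 hWU
    have hlt : (W \ cone L p U).ncard < k := by
      rw [← hk]
      refine Set.ncard_lt_ncard ⟨fun x hx => ⟨hx.1, fun hxU => hx.2 (h.subset_cone hpU hxU)⟩,
        fun hs => ?_⟩ (Set.toFinite _)
      exact (hs ⟨hpW, hpU⟩).2 self_mem_cone
    obtain ⟨s, hs, hsW⟩ := ih _ hlt (hU.join hpU) (cone_subset hW hpU hUW hpW) rfl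
    exact ⟨s, by omega, hsW⟩

theorem exists_isFlat [Finite P] (h : IsProjectiveSpace P L) {W : Set P}
    (hW : IsSubspace L W) : ∃ s, IsFlat L s W := by
  obtain ⟨s, -, hs⟩ := IsFlat.empty.exists_of_subset h hW (Set.empty_subset W)
  exact ⟨s, hs⟩

theorem isSubspace_span (X : Set P) : IsSubspace L (span L X) := by
  intro p hp q hq hpq l hpl hql r hr U hU
  exact hU.1 p (hp U hU) q (hq U hU) hpq l hpl hql r hr

theorem subset_span (X : Set P) : X ⊆ span L X := fun _ hx _ hU => hU.2 hx

theorem span_subset {X U : Set P} (hU : IsSubspace L U) (hX : X ⊆ U) : span L X ⊆ U :=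
  fun _ hx => hx U ⟨hU, hX⟩

theorem span_mono {X Y : Set P} (hXY : X ⊆ Y) : span L X ⊆ span L Y :=
  span_subset (isSubspace_span Y) (hXY.trans (subset_span Y))

theorem span_insert (h : IsProjectiveSpace P L) {X : Set P} {p : P} (hp : p ∉ span L X) :
    span L (insert p X) = cone L p (span L X) := by
  apply Set.Subset.antisymm
  · exact span_subset (h.isSubspace_cone (isSubspace_span X) hp)
      (Set.insert_subset self_mem_cone ((subset_span X).trans (h.subset_cone hp)))
  · exact cone_subset (isSubspace_span _) hp (span_mono (Set.subset_insert p X))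
      (subset_span _ (Set.mem_insert p X))

theorem isFlat_span (h : IsProjectiveSpace P L) (X : Finset P)
    (hX : Independent L (X : Set P)) : IsFlat L X.card (span L (X : Set P)) := by
  classical
  induction X using Finset.induction_on with
  | empty =>
    have : span L ((∅ : Finset P) : Set P) = ∅ :=
      Set.subset_empty_iff.1 (span_subset (fun p hp => hp.elim) (by simp))
    rw [this]
    exact IsFlat.empty
  | insert p X hpX ih =>
    have hsub : (X : Set P) ⊆ (insert p X : Finset P) \ {p} := fun x hx =>
      ⟨by simp [Finset.mem_coe.1 hx], by rintro rfl; exact hpX hx⟩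
    have hp : p ∉ span L (X : Set P) := fun hp => hX p (by simp) (span_mono hsub hp)
    have hXi : Independent L (X : Set P) := fun x hx hxs => hX x (by simp [hx])
      (span_mono (Set.sdiff_subset_sdiff_left (by simp)) hxs)
    rw [Finset.card_insert_of_notMem hpX, Finset.coe_insert, h.span_insert hp]
    exact (ih hXi).join hp

theorem flatCard_add (n r k : ℕ) : flatCard n (r + k) = flatCard n r + n ^ r * flatCard n k := by
  rw [flatCard, Finset.sum_range_add, flatCard, flatCard, Finset.mul_sum]
  simp [pow_add]

theorem HasDimension.isFlat_univ (h : IsProjectiveSpace P L) {d : ℕ}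
    (hd : HasDimension P L d) : IsFlat L (d + 1) (Set.univ : Set P) := by
  obtain ⟨B, hB, hBi, hBs⟩ := hd
  rw [← hB, ← hBs]
  exact h.isFlat_span B hBi

/-- Rank is compared through cardinality, which is strictly increasing in the rank; this takes the
place of an exchange lemma. -/
theorem IsFlat.le_of_subset [Finite P] (h : IsProjectiveSpace P L) {n : ℕ} (hn0 : 0 < n)
    (hn : HasOrder P L n) {r s : ℕ} {U W : Set P} (hU : IsFlat L r U) (hW : IsFlat L s W)
    (hUW : U ⊆ W) : r ≤ s := by
  rw [← (flatCard_strictMono hn0).le_iff_le, ← hU.ncard h hn, ← hW.ncard h hn]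
  exact Set.ncard_le_ncard hUW (Set.toFinite W)

theorem IsFlat.lt_of_ssubset [Finite P] (h : IsProjectiveSpace P L) {n : ℕ} (hn0 : 0 < n)
    (hn : HasOrder P L n) {r s : ℕ} {U W : Set P} (hU : IsFlat L r U) (hW : IsFlat L s W)
    (hUW : U ⊂ W) : r < s := by
  rw [← (flatCard_strictMono hn0).lt_iff_lt, ← hU.ncard h hn, ← hW.ncard h hn]
  exact Set.ncard_lt_ncard hUW (Set.toFinite W)

theorem IsFlat.rank_unique [Finite P] (h : IsProjectiveSpace P L) {n : ℕ} (hn0 : 0 < n)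
    (hn : HasOrder P L n) {r s : ℕ} {U : Set P} (hU : IsFlat L r U) (hU' : IsFlat L s U) :
    r = s :=
  (hU.le_of_subset h hn0 hn hU' subset_rfl).antisymm (hU'.le_of_subset h hn0 hn hU subset_rfl)

/-- By maximality, the cone over a hyperplane from an outside point is the whole space, of rank d +
1. Conversely, nothing fits strictly between ranks d and d + 1. -/
theorem isHyperplane_iff_isFlat [Finite P] (h : IsProjectiveSpace P L) {d n : ℕ} (hn0 : 0 < n)
    (hn : HasOrder P L n) (hd : HasDimension P L d) {U : Set P} :
    IsHyperplane L U ↔ IsFlat L d U := by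
  have huniv := hd.isFlat_univ h
  constructor
  · intro hU
    obtain ⟨r, hr⟩ := h.exists_isFlat hU.prop.1
    obtain ⟨p, hp⟩ := (Set.ne_univ_iff_exists_notMem U).1 hU.prop.2
    have hcone : cone L p U = Set.univ := by
      by_contra hne
      exact hp (hU.le_of_ge ⟨h.isSubspace_cone hU.prop.1 hp, hne⟩ (h.subset_cone hp)
        self_mem_cone)
    have := (hcone ▸ hr.join hp).rank_unique h hn0 hn huniv
    obtain rfl : r = d := by omega
    exact hr
  · intro hU
    refine ⟨⟨hU.isSubspace h, ?_⟩, ?_⟩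
    · rintro rfl
      have := hU.rank_unique h hn0 hn huniv
      omega
    · rintro W ⟨hW, hWne⟩ hUW
      by_contra hWU
      obtain ⟨s, hs⟩ := h.exists_isFlat hW
      have h1 := hU.lt_of_ssubset h hn0 hn hs ⟨hUW, hWU⟩
      have h2 := hs.lt_of_ssubset h hn0 hn huniv (Set.ssubset_univ_iff.2 hWne)
      omega

/-! ### Counting hyperplanes through a flat -/

/-- In a space of dimension `d = r + k` and order `n`, a flat of rank `r` lies on exactly
`1 + n + ⋯ + n ^ k` hyperplanes. -/
theorem IsFlat.ncard_isHyperplane [Finite P] (h : IsProjectiveSpace P L) {n : ℕ} (hn0 : 0 < n)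
    (hn : HasOrder P L n) {r k : ℕ} (hd : HasDimension P L (r + k)) {U : Set P}
    (hU : IsFlat L r U) : {W : Set P | IsHyperplane L W ∧ U ⊆ W}.ncard = flatCard n (k + 1) := by
  classical
  have := Fintype.ofFinite P
  induction k generalizing r U with
  | zero =>
    have hUh : IsHyperplane L U := (h.isHyperplane_iff_isFlat hn0 hn hd).2 hU
    have : {W : Set P | IsHyperplane L W ∧ U ⊆ W} = {U} := by
      ext W
      simp only [Set.mem_ofPred_eq, Set.mem_singleton_iff]
      constructor
      · rintro ⟨hW, hUW⟩
        exact (hUh.eq_of_subset hW.prop hUW).symm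
      · rintro rfl
        exact ⟨hUh, subset_rfl⟩
    simp [this, flatCard]
  | succ k ih =>
    set s : Finset (Set P) := {W | IsHyperplane L W ∧ U ⊆ W} with hs
    set t : Finset P := {p | p ∉ U} with ht
    have hcard : {W : Set P | IsHyperplane L W ∧ U ⊆ W}.ncard = s.card := by
      rw [← Set.ncard_coe_finset, hs]
      simp
    rw [hcard]
    -- Count pairs (W, p) with W a hyperplane through `U` and p in W but not in `U`. The hyperplanes
    -- through `U` and p are those through the cone, a flat of rank r + 1, to which the induction
    -- hypothesis applies.
    have hdc := Finset.sum_card_bipartiteAbove_eq_sum_card_bipartiteBelow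
      (s := s) (t := t) (fun (W : Set P) (p : P) => p ∈ W)
    have h1 : ∀ W ∈ s, (t.bipartiteAbove (fun (W : Set P) (p : P) => p ∈ W) W).card
        = n ^ r * flatCard n (k + 1) := by
      intro W hW
      obtain ⟨hWh, hUW⟩ := (Finset.mem_filter.1 hW).2
      have : ((t.bipartiteAbove (fun (W : Set P) (p : P) => p ∈ W) W : Finset P) : Set P)
          = W \ U := by
        ext x; simp [Finset.bipartiteAbove, ht, and_comm]
      rw [← Set.ncard_coe_finset, this, Set.ncard_sdiff hUW, hU.ncard h hn,
        ((h.isHyperplane_iff_isFlat hn0 hn hd).1 hWh).ncard h hn, flatCard_add,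
        Nat.add_sub_cancel_left]
    have h2 : ∀ p ∈ t, (s.bipartiteBelow (fun (W : Set P) (p : P) => p ∈ W) p).card
        = flatCard n (k + 1) := by
      intro p hp
      have hpU : p ∉ U := (Finset.mem_filter.1 hp).2
      have hd' : HasDimension P L (r + 1 + k) := by convert hd using 1; omega
      rw [← ih hd' (hU.join hpU), ← Set.ncard_coe_finset]
      congr 1
      ext W
      simp only [Finset.bipartiteBelow, hs, Finset.coe_filter, Finset.mem_filter,
        Finset.mem_univ, true_and, Set.mem_ofPred_eq]
      constructor
      · rintro ⟨⟨hW, hUW⟩, hpW⟩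
        exact ⟨hW, cone_subset hW.prop.1 hpU hUW hpW⟩
      · rintro ⟨hW, hcW⟩
        exact ⟨⟨hW, (h.subset_cone hpU).trans hcW⟩, hcW self_mem_cone⟩
    have h3 : t.card = n ^ r * flatCard n (k + 1 + 1) := by
      have : (t : Set P) = Set.univ \ U := by ext; simp [ht]
      rw [← Set.ncard_coe_finset, this, Set.ncard_sdiff (Set.subset_univ U), hU.ncard h hn,
        (hd.isFlat_univ h).ncard h hn, add_assoc, flatCard_add, Nat.add_sub_cancel_left]
    rw [Finset.sum_congr rfl h1, Finset.sum_congr rfl h2, Finset.sum_const, Finset.sum_const,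
      h3, smul_eq_mul, smul_eq_mul] at hdc
    have hpos : 0 < n ^ r * flatCard n (k + 1) :=
      Nat.mul_pos (pow_pos hn0 r) (by rw [flatCard_succ]; omega)
    refine Nat.eq_of_mul_eq_mul_right hpos ?_
    rw [hdc]
    ring

theorem card_points [Fintype P] (h : IsProjectiveSpace P L) {d n : ℕ}
    (hn : HasOrder P L n) (hd : HasDimension P L d) : Fintype.card P = flatCard n (d + 1) := by
  rw [← (hd.isFlat_univ h).ncard h hn, Set.ncard_univ, Nat.card_eq_fintype_card]

open Classical in
theorem card_filter_hyperplane [Fintype P] (h : IsProjectiveSpace P L) {n : ℕ} (hn0 : 0 < n)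
    (hn : HasOrder P L n) {r k : ℕ} (hd : HasDimension P L (r + k)) {U : Set P}
    (hU : IsFlat L r U) :
    (Finset.univ.filter fun W : Hyperplane P L => U ⊆ W.1).card = flatCard n (k + 1) := by
  rw [← hU.ncard_isHyperplane h hn0 hn hd, ← Set.ncard_coe_finset,
    ← Set.ncard_image_of_injective (f := fun W : Hyperplane P L => W.1) _
      (fun _ _ e => Subtype.ext e)]
  congr 1
  ext W
  constructor
  · rintro ⟨W, hW, rfl⟩
    exact ⟨W.2, by simpa using hW⟩
  · rintro ⟨hW, hUW⟩
    exact ⟨⟨W, hW⟩, Finset.mem_coe.2 (Finset.mem_filter.2 ⟨Finset.mem_univ _, hUW⟩), rfl⟩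

theorem card_hyperplane [Fintype P] (h : IsProjectiveSpace P L) {d n : ℕ} (hn0 : 0 < n)
    (hn : HasOrder P L n) (hd : HasDimension P L d) :
    Fintype.card (Hyperplane P L) = flatCard n (d + 1) := by
  classical
  rw [← h.card_filter_hyperplane hn0 hn (r := 0) (k := d) (by rwa [Nat.zero_add]) IsFlat.empty]
  simp

theorem isFlat_singleton (p : P) : IsFlat L 1 {p} := by
  have := (IsFlat.empty (L := L) (P := P)).join (p := p) (by simp)
  simpa [cone] using this

open Classical in
theorem card_hyperplane_mem [Fintype P] (h : IsProjectiveSpace P L) {d n : ℕ} (hn0 : 0 < n)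
    (hn : HasOrder P L n) (hd : HasDimension P L (d + 1)) (p : P) :
    (Finset.univ.filter fun W : Hyperplane P L => p ∈ W.1).card = flatCard n (d + 1) := by
  rw [← h.card_filter_hyperplane hn0 hn (r := 1) (k := d) (by rwa [Nat.add_comm])
    (isFlat_singleton p)]
  simp

open Classical in
theorem card_hyperplane_mem_mem [Fintype P] (h : IsProjectiveSpace P L) {d n : ℕ} (hn0 : 0 < n)
    (hn : HasOrder P L n) (hd : HasDimension P L (d + 2)) {p q : P} (hpq : p ≠ q) :
    (Finset.univ.filter fun W : Hyperplane P L => p ∈ W.1 ∧ q ∈ W.1).card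
      = flatCard n (d + 1) := by
  have hq : q ∉ ({p} : Set P) := fun e => hpq e.symm
  rw [← h.card_filter_hyperplane hn0 hn (r := 2) (k := d) (by rwa [Nat.add_comm])
    ((isFlat_singleton p).join hq)]
  congr 1
  ext W
  simp only [Finset.mem_filter, Finset.mem_univ, true_and]
  constructor
  · rintro ⟨hp, hq'⟩
    exact cone_subset W.2.prop.1 hq (by simpa using hp) hq'
  · intro hW
    exact ⟨hW (h.subset_cone hq rfl), hW self_mem_cone⟩

/-! ### The VC dimension -/

theorem signedIncidence_eq_one {p : P} {W : Hyperplane P L} :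
    signedIncidence P L p W = 1 ↔ p ∈ W.1 := by
  by_cases hp : p ∈ W.1 <;> simp [signedIncidence, hp]

theorem signedIncidence_eq_neg_one {p : P} {W : Hyperplane P L} :
    signedIncidence P L p W = -1 ↔ p ∉ W.1 := by
  by_cases hp : p ∈ W.1 <;> simp [signedIncidence, hp]

theorem isSubspace_inter {U W : Set P} (hU : IsSubspace L U) (hW : IsSubspace L W) :
    IsSubspace L (U ∩ W) := fun p hp q hq hpq l hpl hql r hr =>
  ⟨hU p hp.1 q hq.1 hpq l hpl hql r hr, hW p hp.2 q hq.2 hpq l hpl hql r hr⟩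

theorem card_le_of_shattered [Finite P] (h : IsProjectiveSpace P L) {d n : ℕ} (hn0 : 0 < n)
    (hn : HasOrder P L n) (hd : HasDimension P L d) {T : Finset (Hyperplane P L)}
    (hT : SignMatrix.Shattered (signedIncidence P L) T) : T.card ≤ d := by
  classical
  have key : ∀ T' ⊆ T, ∃ r, IsFlat L r {x : P | ∀ W ∈ T', x ∈ W.1} ∧ r + T'.card ≤ d + 1 := by
    intro T' hT'
    induction T' using Finset.induction_on with
    | empty => exact ⟨d + 1, by simpa using hd.isFlat_univ h, by simp⟩
    | insert W T' hW ih =>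
      obtain ⟨r, hr, hle⟩ := ih ((Finset.subset_insert W T').trans hT')
      have hinter : {x : P | ∀ V ∈ insert W T', x ∈ V.1} = {x : P | ∀ V ∈ T', x ∈ V.1} ∩ W.1 := by
        ext x
        simp [and_comm]
      obtain ⟨s, hs⟩ := h.exists_isFlat (isSubspace_inter (hr.isSubspace h) W.2.prop.1)
      -- A row with -1 at `W` and +1 elsewhere is a point of the previous intersection outside `W`,
      -- so the rank drops.
      obtain ⟨x, hx⟩ := hT fun V => if V = W then -1 else 1
      have hxW : x ∉ W.1 := by
        rw [← signedIncidence_eq_neg_one, hx W (hT' (Finset.mem_insert_self W T')), if_pos rfl]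
      have hxT' : ∀ V ∈ T', x ∈ V.1 := fun V hV => by
        rw [← signedIncidence_eq_one, hx V (hT' (Finset.mem_insert_of_mem hV)),
          if_neg (by rintro rfl; exact hW hV)]
      have hlt := hs.lt_of_ssubset h hn0 hn hr
        ⟨Set.inter_subset_left, fun hsub => hxW (hsub hxT').2⟩
      refine ⟨s, hinter ▸ hs, ?_⟩
      rw [Finset.card_insert_of_notMem hW]
      omega
  obtain ⟨r, hr, hle⟩ := key T subset_rfl
  -- The all-ones pattern makes the final rank at least 1, improving the bound from d + 1 to d.
  obtain ⟨x, hx⟩ := hT fun _ => 1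
  have hxmem : x ∈ {x : P | ∀ W ∈ T, x ∈ W.1} := fun W hW => signedIncidence_eq_one.1 (hx W hW)
  have hr0 : 1 ≤ r := (isFlat_singleton x).le_of_subset h hn0 hn hr (by simpa using hxmem)
  omega

theorem exists_third_point (h : IsProjectiveSpace P L) (l : L) (p q : P) :
    ∃ r, r ∈ l ∧ r ≠ p ∧ r ≠ q := by
  obtain ⟨a, b, c, hab, hac, hbc, ha, hb, hc⟩ := h.three_points l
  grind

theorem exists_shattered [Finite P] (h : IsProjectiveSpace P L) {d n : ℕ} (hn0 : 0 < n)
    (hn : HasOrder P L n) (hd : HasDimension P L d) :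
    ∃ T : Finset (Hyperplane P L), T.card = d ∧
      SignMatrix.Shattered (signedIncidence P L) T := by
  classical
  obtain ⟨B, hB, hBi, hBs⟩ := id hd
  have hex : ∀ b ∈ B, ∃ W : Hyperplane P L, (∀ c ∈ B, c ≠ b → c ∈ W.1) ∧ b ∉ W.1 := by
    intro b hb
    have hsub : ((B.erase b : Finset P) : Set P) = (B : Set P) \ {b} := Finset.coe_erase b B
    have hi : Independent L ((B.erase b : Finset P) : Set P) := fun x hx hxs =>
      hBi x (Finset.mem_of_mem_erase hx) (span_mono (Set.sdiff_subset_sdiff_left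
        (by simp)) hxs)
    have hflat := h.isFlat_span _ hi
    rw [Finset.card_erase_of_mem hb, hB, Nat.add_sub_cancel, hsub] at hflat
    exact ⟨⟨_, (h.isHyperplane_iff_isFlat hn0 hn hd).2 hflat⟩,
      fun c hc hcb => subset_span _ ⟨hc, hcb⟩, hBi b hb⟩
  -- The vertex `b₀` lies on the face opposite every other vertex, so it realises the pattern with
  -- no -1 and starts the induction.
  obtain ⟨b₀, hb₀⟩ : B.Nonempty := Finset.card_pos.1 (by omega)
  have : Nonempty (Hyperplane P L) := ⟨(hex b₀ hb₀).choose⟩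
  choose! f hf hbf using hex
  have hpt : ∀ J ⊆ B.erase b₀, ∃ p, ∀ b ∈ B.erase b₀, p ∈ (f b).1 ↔ b ∉ J := by
    intro J hJ
    induction J using Finset.induction_on with
    | empty =>
      refine ⟨b₀, fun b hb => ?_⟩
      rw [Finset.mem_erase] at hb
      simpa using hf b hb.2 b₀ hb₀ (Ne.symm hb.1)
    | insert i J hi ih =>
      obtain ⟨p, hp⟩ := ih ((Finset.subset_insert i J).trans hJ)
      have hiB := hJ (Finset.mem_insert_self i J)
      have hpi : p ∈ (f i).1 := (hp i hiB).2 hi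
      rw [Finset.mem_erase] at hiB
      have hne : p ≠ i := by rintro rfl; exact hbf p hiB.2 hpi
      -- Moving `p` to a third point of its line with `i` leaves the face `f i`, as `i` is off it.
      -- Membership in every other face is unchanged, as `i` lies on it.
      obtain ⟨l, hpl, hil⟩ := h.exists_line hne
      obtain ⟨q, hql, hqp, hqi⟩ := h.exists_third_point l p i
      refine ⟨q, fun b hb => ?_⟩
      have hsub : IsSubspace L (f b).1 := (f b).2.prop.1
      have hpb := hp b hb
      rw [Finset.mem_erase] at hb
      rw [Finset.mem_insert, not_or, ← hpb]
      by_cases hbi : b = i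
      · subst hbi
        simp only [not_true_eq_false, false_and, iff_false]
        exact fun hq => hbf b hb.2 (hsub p hpi q hq (Ne.symm hqp) l hpl hql b hil)
      · have hib := hf b hb.2 i hiB.2 (Ne.symm hbi)
        constructor
        · exact fun hq => ⟨hbi, hsub q hq i hib hqi l hql hil p hpl⟩
        · exact fun hp' => hsub p hp'.2 i hib hne l hpl hil q hql
  refine ⟨(B.erase b₀).image f, ?_, ?_⟩
  · rw [Finset.card_image_of_injOn, Finset.card_erase_of_mem hb₀, hB, Nat.add_sub_cancel]
    intro b hb c hc hbc
    by_contra hne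
    simp only [Finset.coe_erase, Set.mem_sdiff, Finset.mem_coe] at hb hc
    exact hbf b hb.1 (hbc ▸ hf c hc.1 b hb.1 hne)
  · intro v
    obtain ⟨p, hp⟩ := hpt ((B.erase b₀).filter fun b => v (f b) = -1) (Finset.filter_subset _ _)
    refine ⟨p, fun W hW => ?_⟩
    obtain ⟨b, hb, rfl⟩ := Finset.mem_image.1 hW
    have hpb := hp b hb
    rw [Finset.mem_filter, not_and] at hpb
    rcases Int.units_eq_one_or (v (f b)) with hv | hv
    · rw [hv, signedIncidence_eq_one, hpb, hv]
      simp
    · rw [hv, signedIncidence_eq_neg_one, hpb, hv]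
      simpa using hb

theorem vcDim_signedIncidence [Finite P] (h : IsProjectiveSpace P L) {d n : ℕ} (hn0 : 0 < n)
    (hn : HasOrder P L n) (hd : HasDimension P L d) :
    SignMatrix.vcDim (signedIncidence P L) = d := by
  refine IsGreatest.csSup_eq ⟨h.exists_shattered hn0 hn hd, ?_⟩
  rintro k ⟨T, rfl, hT⟩
  exact h.card_le_of_shattered hn0 hn hd hT

end IsProjectiveSpace

/-! ### Radial isotropy and Forster's theorem -/

open scoped RealInnerProductSpace

namespace SignMatrix

variable {E : Type*} [NormedAddCommGroup E] [InnerProductSpace ℝ E] {k : ℕ}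

/-- **Hadamard's inequality**. -/
theorem abs_det_le_prod_norm (b : OrthonormalBasis (Fin k) ℝ E) (v : Fin k → E) :
    |b.toBasis.det v| ≤ ∏ i, ‖v i‖ := by
  have : Fact (Module.finrank ℝ E = k) := ⟨by
    simpa using Module.finrank_eq_card_basis b.toBasis⟩
  rw [← b.toBasis.orientation.volumeForm_robust' b]
  exact b.toBasis.orientation.abs_volumeForm_apply_le v

/-- The family is the image of the basis `b` under s·id plus a rank-one map; the two conditions keep
that map invertible. It serves to replace one vector by a nearby basis. -/
theorem linearIndependent_add_smul (b : OrthonormalBasis (Fin k) ℝ E) {x : E} {s : ℝ}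
    (hs : s ≠ 0) (hsx : s + ∑ l, ⟪b l, x⟫ ≠ 0) :
    LinearIndependent ℝ fun l => x + s • b l := by
  rw [Fintype.linearIndependent_iff]
  intro c hc
  have h1 : ∀ m, (∑ l, c l) * ⟪b m, x⟫ + s * c m = 0 := by
    intro m
    have := congrArg (fun e => ⟪b m, e⟫) hc
    simp only [smul_add, Finset.sum_add_distrib, ← Finset.sum_smul, inner_add_right,
      inner_smul_right, inner_sum, smul_smul, inner_zero_right, b.inner_eq_ite] at this
    simpa [mul_comm] using this
  have h2 : (∑ l, c l) * (s + ∑ l, ⟪b l, x⟫) = 0 := by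
    have : ∑ m, ((∑ l, c l) * ⟪b m, x⟫ + s * c m) = 0 := Finset.sum_eq_zero fun m _ => h1 m
    rw [Finset.sum_add_distrib, ← Finset.mul_sum, ← Finset.mul_sum] at this
    linarith
  have h3 : ∑ l, c l = 0 := (mul_eq_zero.1 h2).resolve_right hsx
  intro m
  have := h1 m
  rw [h3, zero_mul, zero_add] at this
  exact (mul_eq_zero.1 this).resolve_left hs

theorem det_ne_zero_of_linearIndependent (b : OrthonormalBasis (Fin k) ℝ E) {v : Fin k → E}
    (hv : LinearIndependent ℝ v) : b.toBasis.det v ≠ 0 := by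
  have := b.toBasis.finiteDimensional_of_finite
  refine (b.toBasis.is_basis_iff_det.1 ⟨hv, hv.span_eq_top_of_card_eq_finrank' ?_⟩).ne_zero
  simpa using (Module.finrank_eq_card_basis b.toBasis).symm

/-- The potential minimised by linear maps taking the vectors `z i l` to radially isotropic
position. -/
noncomputable def potential {R : Type*} [Fintype R] (z : R → Fin k → E) (A : E →ₗ[ℝ] E) : ℝ :=
  ∑ i, ∑ l, Real.log ‖A (z i l)‖ - Fintype.card R * Real.log |LinearMap.det A|

theorem apply_ne_zero_of_det_ne_zero [FiniteDimensional ℝ E] {A : E →ₗ[ℝ] E}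
    (hA : LinearMap.det A ≠ 0) {v : E} (hv : v ≠ 0) : A v ≠ 0 := by
  intro h
  exact hv ((LinearMap.equivOfDetNeZero A hA).map_eq_zero_iff.1 h)

/-- Hadamard's inequality, applied to each transformed basis, bounds the potential below, so its
infimum exists. -/
theorem le_potential {R : Type*} [Fintype R] (b : OrthonormalBasis (Fin k) ℝ E)
    {z : R → Fin k → E} (hz : ∀ i, LinearIndependent ℝ (z i)) {A : E →ₗ[ℝ] E}
    (hA : LinearMap.det A ≠ 0) :
    ∑ i, Real.log |b.toBasis.det (z i)| ≤ potential z A := by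
  have := b.toBasis.finiteDimensional_of_finite
  have h : ∀ i, Real.log |b.toBasis.det (z i)| + Real.log |LinearMap.det A|
      ≤ ∑ l, Real.log ‖A (z i l)‖ := by
    intro i
    have hzi := det_ne_zero_of_linearIndependent b (hz i)
    rw [← Real.log_prod (fun l _ => norm_ne_zero_iff.2
      (apply_ne_zero_of_det_ne_zero hA ((hz i).ne_zero l))), add_comm,
      ← Real.log_mul (abs_ne_zero.2 hA) (abs_ne_zero.2 hzi), ← abs_mul, ← b.toBasis.det_comp]
    exact Real.log_le_log (abs_pos.2 (by rw [b.toBasis.det_comp]; exact mul_ne_zero hA hzi))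
      (abs_det_le_prod_norm b _)
  have := Finset.sum_le_sum fun i (_ : i ∈ Finset.univ) => h i
  rw [Finset.sum_add_distrib, Finset.sum_const, Finset.card_univ, nsmul_eq_mul] at this
  rw [potential]
  linarith

theorem norm_add_smul_sq {v y : E} (hv : ‖v‖ = 1) (s : ℝ) :
    ‖y + (s * ⟪v, y⟫) • v‖ ^ 2 = ‖y‖ ^ 2 + (2 * s + s ^ 2) * ⟪v, y⟫ ^ 2 := by
  rw [norm_add_sq_real, inner_smul_right, norm_smul, hv, mul_one, Real.norm_eq_abs, sq_abs,
    real_inner_comm]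
  ring

/-- A family of bases can be brought arbitrarily close to radially isotropic position. -/
theorem exists_almost_isotropic {R : Type*} [Fintype R] (b : OrthonormalBasis (Fin k) ℝ E)
    {z : R → Fin k → E} (hz : ∀ i, LinearIndependent ℝ (z i)) {δ : ℝ} (hδ : 0 < δ) :
    ∃ A : E →ₗ[ℝ] E, LinearMap.det A ≠ 0 ∧ ∀ v : E, ‖v‖ = 1 →
      Fintype.card R - δ ≤ ∑ i, ∑ l, (⟪v, A (z i l)⟫ / ‖A (z i l)‖) ^ 2 := by
  have := b.toBasis.finiteDimensional_of_finite
  set N : ℝ := ((Fintype.card R : ℕ) : ℝ) with hN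
  have hN0 : 0 ≤ N := Nat.cast_nonneg _
  -- With t = (1 + s)² - 1, the second-order error N·t must cost at most δ/2.
  obtain ⟨s, hs0, hs⟩ : ∃ s : ℝ, 0 < s ∧ (2 * s + s ^ 2) * (N + 1) ≤ δ / 2 := by
    have hc : Filter.Tendsto (fun s : ℝ => (2 * s + s ^ 2) * (N + 1)) (nhdsWithin 0 (Set.Ioi 0))
        (nhds 0) := by
      have : Continuous fun s : ℝ => (2 * s + s ^ 2) * (N + 1) := by fun_prop
      simpa using (this.tendsto 0).mono_left nhdsWithin_le_nhds
    obtain ⟨s, h1, h2⟩ := ((hc.eventually_le_const (half_pos hδ)).and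
      self_mem_nhdsWithin).exists
    exact ⟨s, h2, h1⟩
  set t : ℝ := 2 * s + s ^ 2 with ht
  have ht0 : 0 < t := by positivity
  set S : Set ℝ := potential z '' {A | LinearMap.det A ≠ 0} with hS
  have hSne : S.Nonempty := ⟨_, LinearMap.id, by simp, rfl⟩
  have hSb : BddBelow S := by
    refine ⟨∑ i, Real.log |b.toBasis.det (z i)|, ?_⟩
    rintro _ ⟨A, hA, rfl⟩
    exact le_potential b hz hA
  -- A near-minimiser is enough, so no compactness is needed. The tolerance is proportional to t
  -- because the inequality is divided by t at the end.
  obtain ⟨_, ⟨A, hA, rfl⟩, hlt⟩ := exists_lt_of_csInf_lt hSne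
    (lt_add_of_pos_right (sInf S) (show 0 < t * δ / 4 by positivity))
  refine ⟨A, hA, fun v hv => ?_⟩
  -- `T` stretches by 1 + s along `v`. As `T ∘ₗ A` cannot lower the potential by much, the vectors
  -- must have enough mass in direction `v`.
  set T : E →ₗ[ℝ] E := LinearMap.transvection (s • (innerₛₗ ℝ v)) v with hT
  have hTapp : ∀ y, T y = y + (s * ⟪v, y⟫) • v := fun y => by
    simp [hT, LinearMap.transvection.apply]
  have hTdet : LinearMap.det T = 1 + s := by
    simp [hT, hv]
  have hTA : LinearMap.det (T ∘ₗ A) ≠ 0 := by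
    rw [LinearMap.det_comp, hTdet]
    exact mul_ne_zero (by positivity) hA
  have hle : potential z A - t * δ / 4 ≤ potential z (T ∘ₗ A) := by
    have := csInf_le hSb (show potential z (T ∘ₗ A) ∈ S from ⟨_, hTA, rfl⟩)
    linarith
  set c : R → Fin k → ℝ := fun i l => (⟪v, A (z i l)⟫ / ‖A (z i l)‖) ^ 2 with hc
  have hlog : ∀ i l, Real.log ‖T (A (z i l))‖ ≤ Real.log ‖A (z i l)‖ + t / 2 * c i l := by
    intro i l
    have hy0 : A (z i l) ≠ 0 := apply_ne_zero_of_det_ne_zero hA ((hz i).ne_zero l)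
    set y := A (z i l) with hy
    have hy1 : 0 < ‖y‖ := norm_pos_iff.2 hy0
    have hci : 0 ≤ c i l := sq_nonneg _
    have h1 : ‖T y‖ ^ 2 = ‖y‖ ^ 2 * (1 + t * c i l) := by
      rw [hTapp, norm_add_smul_sq hv]
      simp only [hc, ← hy]
      field_simp
      rw [ht]
      ring
    have h2 : 2 * Real.log ‖T y‖ = 2 * Real.log ‖y‖ + Real.log (1 + t * c i l) := by
      have := congrArg Real.log h1
      rw [Real.log_mul (by positivity) (by positivity), Real.log_pow, Real.log_pow] at this
      exact_mod_cast this
    have h3 := Real.log_le_sub_one_of_pos (show 0 < 1 + t * c i l by positivity)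
    linarith
  have hsum : ∑ i, ∑ l, Real.log ‖T (A (z i l))‖
      ≤ ∑ i, ∑ l, Real.log ‖A (z i l)‖ + t / 2 * ∑ i, ∑ l, c i l := by
    rw [Finset.mul_sum, ← Finset.sum_add_distrib]
    refine Finset.sum_le_sum fun i _ => ?_
    rw [Finset.mul_sum, ← Finset.sum_add_distrib]
    exact Finset.sum_le_sum fun l _ => hlog i l
  have hlogt : t * (1 - t) ≤ 2 * Real.log (1 + s) := by
    have h1 : 2 * Real.log (1 + s) = Real.log (1 + t) := by
      rw [show 1 + t = (1 + s) ^ 2 by rw [ht]; ring, Real.log_pow]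
      norm_num
    have h2 := Real.one_sub_inv_le_log_of_pos (show 0 < 1 + t by positivity)
    have h3 : t * (1 - t) ≤ 1 - (1 + t)⁻¹ := by
      have : 1 - (1 + t)⁻¹ = t / (1 + t) := by field_simp; ring
      rw [this, le_div_iff₀ (by positivity)]
      nlinarith [pow_pos ht0 3]
    linarith
  have hmain : N * Real.log (1 + s) - t * δ / 4 ≤ t / 2 * ∑ i, ∑ l, c i l := by
    have hs1 : 0 < 1 + s := by positivity
    simp only [potential, LinearMap.comp_apply, LinearMap.det_comp, hTdet, abs_mul,
      abs_of_pos hs1] at hle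
    rw [Real.log_mul hs1.ne' (abs_ne_zero.2 hA)] at hle
    linarith
  have h5 : t * (N * (1 - t) - δ / 2) ≤ t * ∑ i, ∑ l, c i l := by
    nlinarith [mul_le_mul_of_nonneg_left hlogt hN0]
  have h6 := le_of_mul_le_mul_left h5 ht0
  nlinarith

/-- An approximate form of Forster's theorem: vectors realising a sign pattern in dimension `k`
can be chosen in the unit ball with `∑ |⟪u i, w j⟫|` nearly `|R| |C| / k`. -/
theorem exists_forster {R C : Type*} [Fintype R] [Fintype C] [Nonempty R]
    (b : OrthonormalBasis (Fin k) ℝ E) (hk : 0 < k) (x : R → E) (y : C → E)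
    (hxy : ∀ i j, ⟪x i, y j⟫ ≠ 0) {δ : ℝ} (hδ : 0 < δ) :
    ∃ (u : R → E) (w : C → E), (∀ i, ‖u i‖ ≤ 1) ∧ (∀ j, ‖w j‖ ≤ 1) ∧
      (∀ i j, 0 < ⟪u i, w j⟫ * ⟪x i, y j⟫) ∧
      (Fintype.card R - δ) * Fintype.card C ≤ k * ∑ i, ∑ j, |⟪u i, w j⟫| := by
  have := b.toBasis.finiteDimensional_of_finite
  have hk' : (0 : ℝ) < k := Nat.cast_pos.2 hk
  -- Each `x i` is replaced by k nearby independent vectors with the same signs against all `y j`,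
  -- so no general position of the `x i` is required.
  obtain ⟨s, hs1, hs2, hs3⟩ : ∃ s : ℝ, s ≠ 0 ∧ (∀ i, s + ∑ l, ⟪b l, x i⟫ ≠ 0) ∧
      ∀ i l j, 0 < ⟪x i + s • b l, y j⟫ * ⟪x i, y j⟫ := by
    have h1 : ∀ᶠ s : ℝ in nhdsWithin 0 {0}ᶜ, s ≠ 0 := self_mem_nhdsWithin
    have h2 : ∀ᶠ s : ℝ in nhdsWithin 0 {0}ᶜ, ∀ i, s + ∑ l, ⟪b l, x i⟫ ≠ 0 := by
      rw [Filter.eventually_all]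
      intro i
      by_cases h0 : ∑ l, ⟪b l, x i⟫ = 0
      · simpa [h0] using h1
      · have : Continuous fun s : ℝ => s + ∑ l, ⟪b l, x i⟫ := by fun_prop
        exact (this.continuousAt.eventually_ne (by simpa using h0)).filter_mono
          nhdsWithin_le_nhds
    have h3 : ∀ᶠ s : ℝ in nhdsWithin 0 {0}ᶜ,
        ∀ i l j, 0 < ⟪x i + s • b l, y j⟫ * ⟪x i, y j⟫ := by
      simp only [Filter.eventually_all]
      intro i l j
      have : Continuous fun s : ℝ => ⟪x i + s • b l, y j⟫ * ⟪x i, y j⟫ := by fun_prop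
      refine (this.continuousAt.eventually_const_lt ?_).filter_mono nhdsWithin_le_nhds
      simpa using mul_self_pos.2 (hxy i j)
    exact (h1.and (h2.and h3)).exists
  set z : R → Fin k → E := fun i l => x i + s • b l with hz
  have hzi : ∀ i, LinearIndependent ℝ (z i) := fun i => linearIndependent_add_smul b hs1 (hs2 i)
  obtain ⟨A, hA, hiso⟩ := exists_almost_isotropic b hzi hδ
  have hAz : ∀ i l, 0 < ‖A (z i l)‖ := fun i l =>
    norm_pos_iff.2 (apply_ne_zero_of_det_ne_zero hA ((hzi i).ne_zero l))
  set e := LinearMap.equivOfDetNeZero A hA with he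
  -- The inverse adjoint on the `y j` preserves all pairings, hence all signs.
  set y' : C → E := fun j => LinearMap.adjoint (e.symm : E →ₗ[ℝ] E) (y j) with hy'
  have hinner : ∀ i l j, ⟪A (z i l), y' j⟫ = ⟪z i l, y j⟫ := by
    intro i l j
    rw [hy', LinearMap.adjoint_inner_right]
    congr 1
    exact e.symm_apply_apply (z i l)
  have hy0 : ∀ j, 0 < ‖y' j‖ := by
    intro j
    obtain ⟨i⟩ := ‹Nonempty R›
    refine norm_pos_iff.2 fun h0 => ?_
    have h1 : 0 < ⟪z i ⟨0, hk⟩, y j⟫ * ⟪x i, y j⟫ := hs3 i ⟨0, hk⟩ j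
    have h2 := hinner i ⟨0, hk⟩ j
    rw [h0, inner_zero_right] at h2
    rw [← h2, zero_mul] at h1
    exact lt_irrefl _ h1
  set q : R → Fin k → E := fun i l => ‖A (z i l)‖⁻¹ • A (z i l) with hq
  set w : C → E := fun j => ‖y' j‖⁻¹ • y' j with hw
  have hqn : ∀ i l, ‖q i l‖ = 1 := fun i l => by
    simp [hq, norm_smul, (hAz i l).ne']
  have hwn : ∀ j, ‖w j‖ = 1 := fun j => by simp [hw, norm_smul, (hy0 j).ne']
  have hqw : ∀ i l j, 0 < ⟪q i l, w j⟫ * ⟪x i, y j⟫ := by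
    intro i l j
    simp only [hq, hw, inner_smul_left, inner_smul_right, hinner, RCLike.conj_to_real]
    have := hs3 i l j
    have h1 := hAz i l
    have h2 := hy0 j
    calc (0 : ℝ) < ‖A (z i l)‖⁻¹ * ‖y' j‖⁻¹ * (⟪x i + s • b l, y j⟫ * ⟪x i, y j⟫) := by positivity
      _ = _ := by ring
  -- Averaging loses nothing: for fixed i and j all ⟪q i l, w j⟫ have the same sign.
  set u : R → E := fun i => (k : ℝ)⁻¹ • ∑ l, q i l with hu
  have huw : ∀ i j, ⟪u i, w j⟫ = (k : ℝ)⁻¹ * ∑ l, ⟪q i l, w j⟫ := fun i j => by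
    simp [hu, inner_smul_left, sum_inner]
  have huw' : ∀ i j, k * |⟪u i, w j⟫| = ∑ l, |⟪q i l, w j⟫| := by
    intro i j
    rw [huw, abs_mul, abs_of_pos (inv_pos.2 hk'), mul_inv_cancel_left₀ hk'.ne']
    rcases (hxy i j).lt_or_gt with h | h
    · have hneg : ∀ l, ⟪q i l, w j⟫ < 0 := fun l => by
        by_contra hcon
        exact absurd (hqw i l j) (not_lt.2 (mul_nonpos_of_nonneg_of_nonpos (not_lt.1 hcon) h.le))
      rw [abs_of_nonpos (Finset.sum_nonpos fun l _ => (hneg l).le), ← Finset.sum_neg_distrib]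
      exact Finset.sum_congr rfl fun l _ => (abs_of_neg (hneg l)).symm
    · have hpos : ∀ l, 0 < ⟪q i l, w j⟫ := fun l => pos_of_mul_pos_left (hqw i l j) h.le
      rw [abs_of_nonneg (Finset.sum_nonneg fun l _ => (hpos l).le)]
      exact Finset.sum_congr rfl fun l _ => (abs_of_pos (hpos l)).symm
  refine ⟨u, w, fun i => ?_, fun j => (hwn j).le, fun i j => ?_, ?_⟩
  · rw [hu, norm_smul, norm_inv, Real.norm_natCast, inv_mul_le_iff₀ hk', mul_one]
    calc ‖∑ l, q i l‖ ≤ ∑ l, ‖q i l‖ := norm_sum_le _ _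
      _ = k := by simp [hqn]
  · rw [huw, mul_assoc, Finset.sum_mul]
    exact mul_pos (inv_pos.2 hk') (Finset.sum_pos (fun l _ => hqw i l j) ⟨⟨0, hk⟩, by simp⟩)
  · have hcol : ∀ j, (Fintype.card R - δ : ℝ) ≤ ∑ i, ∑ l, |⟪q i l, w j⟫| := by
      intro j
      refine (hiso (w j) (hwn j)).trans
        (Finset.sum_le_sum fun i _ => Finset.sum_le_sum fun l _ => ?_)
      have h1 : ⟪w j, A (z i l)⟫ / ‖A (z i l)‖ = ⟪q i l, w j⟫ := by
        simp only [hq, inner_smul_left, RCLike.conj_to_real, real_inner_comm]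
        rw [div_eq_inv_mul]
      have h2 : |⟪q i l, w j⟫| ≤ 1 := by
        simpa [hqn, hwn] using abs_real_inner_le_norm (q i l) (w j)
      -- As |a| ≤ 1 gives a² ≤ |a|, the quadratic isotropy bound becomes a bound on absolute values.
      rw [h1, ← sq_abs, sq]
      exact mul_le_of_le_one_left (abs_nonneg _) h2
    have := Finset.sum_le_sum fun j (_ : j ∈ Finset.univ) => hcol j
    rw [Finset.sum_const, Finset.card_univ, nsmul_eq_mul, mul_comm] at this
    refine this.trans (le_of_eq ?_)
    rw [Finset.sum_comm, Finset.mul_sum]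
    refine Finset.sum_congr rfl fun i _ => ?_
    rw [Finset.mul_sum]
    exact Finset.sum_congr rfl fun j _ => (huw' i j).symm

/-! ### The spectral lower bound for sign rank -/

theorem exists_inner_eq_of_rank {R C : Type*} [Fintype R] [Fintype C] (M : Matrix R C ℝ) :
    ∃ (x : R → EuclideanSpace ℝ (Fin M.rank)) (y : C → EuclideanSpace ℝ (Fin M.rank)),
      ∀ i j, ⟪x i, y j⟫ = M i j := by
  classical
  have hb : Module.finrank ℝ (LinearMap.range M.mulVecLin) = M.rank := rfl
  let b := Module.finBasisOfFinrankEq ℝ _ hb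
  have hcol : ∀ j, M.mulVecLin (Pi.single j 1) ∈ LinearMap.range M.mulVecLin :=
    fun j => LinearMap.mem_range_self _ _
  refine ⟨fun i => WithLp.toLp 2 fun l => (b l : R → ℝ) i,
    fun j => WithLp.toLp 2 fun l => b.repr ⟨_, hcol j⟩ l, fun i j => ?_⟩
  have h1 := congrArg (fun v : LinearMap.range M.mulVecLin => (v : R → ℝ) i)
    (b.sum_repr ⟨_, hcol j⟩)
  simp only [Submodule.coe_sum, Finset.sum_apply, Submodule.coe_smul, Pi.smul_apply,
    smul_eq_mul, Matrix.mulVecLin_apply, Matrix.mulVec_single_one, Matrix.col_apply] at h1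
  rw [← h1]
  simp [PiLp.inner_apply]

theorem exists_rank_eq_signRank {R C : Type*} [Fintype C] (S : Matrix R C ℤˣ) :
    ∃ M : Matrix R C ℝ, (∀ i j, Real.sign (M i j) = ((S i j : ℤ) : ℝ)) ∧
      M.rank = signRank S := by
  refine Nat.sInf_mem (s := {r | ∃ M : Matrix R C ℝ,
    (∀ i j, Real.sign (M i j) = ((S i j : ℤ) : ℝ)) ∧ M.rank = r})
    ⟨_, Matrix.of fun i j => ((S i j : ℤ) : ℝ), fun i j => ?_, rfl⟩
  rcases Int.units_eq_one_or (S i j) with h | h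
  · simp [h]
  · simp [h, Real.sign_of_neg]

/-- Since β ≤ 0, GGᵀ ≤ αI, so G has operator norm at most √α; two uses of Cauchy–Schwarz then give
the bound. -/
theorem bilinear_le_of_gram {R C E : Type*} [Fintype R] [Fintype C] [DecidableEq R]
    [NormedAddCommGroup E] [InnerProductSpace ℝ E] {G : Matrix R C ℝ} {α β : ℝ} (hα : 0 ≤ α)
    (hβ : β ≤ 0) (hG : ∀ i i', ∑ j, G i j * G i' j = (if i = i' then α else 0) + β)
    {u : R → E} {w : C → E} (hu : ∀ i, ‖u i‖ ≤ 1) (hw : ∀ j, ‖w j‖ ≤ 1) :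
    ∑ i, ∑ j, G i j * ⟪u i, w j⟫ ≤ √(Fintype.card R * Fintype.card C * α) := by
  set a : C → E := fun j => ∑ i, G i j • u i with ha
  have h1 : ∑ i, ∑ j, G i j * ⟪u i, w j⟫ ≤ ∑ j, ‖a j‖ := by
    rw [Finset.sum_comm]
    refine Finset.sum_le_sum fun j _ => ?_
    have : ∑ i, G i j * ⟪u i, w j⟫ = ⟪a j, w j⟫ := by
      simp [ha, sum_inner, inner_smul_left]
    rw [this]
    exact (real_inner_le_norm _ _).trans (mul_le_of_le_one_right (norm_nonneg _) (hw j))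
  have h2 : ∑ j, ‖a j‖ ^ 2 ≤ Fintype.card R * α := by
    have h3 : ∑ j, ‖a j‖ ^ 2 = α * ∑ i, ‖u i‖ ^ 2 + β * ‖∑ i, u i‖ ^ 2 := by
      calc ∑ j, ‖a j‖ ^ 2 = ∑ j, ∑ i, ∑ i', G i j * G i' j * ⟪u i, u i'⟫ := by
            refine Finset.sum_congr rfl fun j _ => ?_
            rw [← real_inner_self_eq_norm_sq, ha, sum_inner]
            refine Finset.sum_congr rfl fun i _ => ?_
            rw [inner_sum]
            refine Finset.sum_congr rfl fun i' _ => ?_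
            rw [real_inner_smul_left, real_inner_smul_right, mul_assoc]
        _ = ∑ i, ∑ i', ((if i = i' then α else 0) + β) * ⟪u i, u i'⟫ := by
            rw [Finset.sum_comm]
            refine Finset.sum_congr rfl fun i _ => ?_
            rw [Finset.sum_comm]
            refine Finset.sum_congr rfl fun i' _ => ?_
            rw [← Finset.sum_mul, hG]
        _ = _ := by
            simp only [add_mul, Finset.sum_add_distrib, ite_mul, zero_mul, Finset.sum_ite_eq,
              Finset.mem_univ, if_true, real_inner_self_eq_norm_sq, ← Finset.mul_sum]
            rw [← real_inner_self_eq_norm_sq (∑ i, u i), sum_inner]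
            simp only [inner_sum]
    have h4 : ∑ i, ‖u i‖ ^ 2 ≤ Fintype.card R := by
      refine (Finset.sum_le_sum fun i _ =>
        (pow_le_one₀ (norm_nonneg _) (hu i) : ‖u i‖ ^ 2 ≤ 1)).trans ?_
      simp
    rw [h3]
    nlinarith [mul_le_mul_of_nonneg_left h4 hα, mul_nonpos_of_nonpos_of_nonneg hβ
      (sq_nonneg ‖∑ i, u i‖)]
  refine h1.trans (Real.le_sqrt_of_sq_le ?_)
  calc (∑ j, ‖a j‖) ^ 2 ≤ Fintype.card C * ∑ j, ‖a j‖ ^ 2 := by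
        simpa using sq_sum_le_card_mul_sum_sq (s := (Finset.univ : Finset C)) (f := fun j => ‖a j‖)
    _ ≤ Fintype.card C * (Fintype.card R * α) := by gcongr
    _ = _ := by ring

/-- A spectral lower bound for the sign rank of a square sign matrix each of whose rows has `D`
positive entries, any two rows having `c` common positive entries. -/
theorem le_signRank_mul_sqrt {R C : Type*} [Fintype R] [Fintype C] [Nonempty R]
    (S : Matrix R C ℤˣ) {N D c : ℕ} (hR : Fintype.card R = N) (hC : Fintype.card C = N)
    (hD : ∀ i, (Finset.univ.filter fun j => S i j = 1).card = D)
    (hc : ∀ i i', i ≠ i' → (Finset.univ.filter fun j => S i j = 1 ∧ S i' j = 1).card = c)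
    (hcD : c ≤ D) (hDN : 2 * D ≤ N) (hcN : c * N ≤ D ^ 2) :
    (D : ℝ) ≤ signRank S * √((D : ℝ) - c) := by
  classical
  obtain ⟨M, hM, hMr⟩ := exists_rank_eq_signRank S
  rw [← hMr]
  obtain ⟨x, y, hxy⟩ := exists_inner_eq_of_rank M
  have hN : 0 < N := hR ▸ Fintype.card_pos
  have hN' : (0 : ℝ) < N := Nat.cast_pos.2 hN
  have hMne : ∀ i j, M i j ≠ 0 := by
    intro i j h0
    have := hM i j
    rw [h0, Real.sign_zero] at this
    exact (S i j).ne_zero (by exact_mod_cast this.symm)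
  have hk : 0 < M.rank := by
    obtain ⟨i⟩ := ‹Nonempty R›
    obtain ⟨j⟩ : Nonempty C := Fintype.card_pos_iff.1 (hC ▸ hN)
    rw [Nat.pos_iff_ne_zero]
    intro h0
    have : IsEmpty (Fin M.rank) := by rw [h0]; infer_instance
    refine hMne i j ?_
    rw [← hxy i j, PiLp.inner_apply]
    simp
  set B : Matrix R C ℝ := Matrix.of fun i j => if S i j = 1 then 1 else 0 with hB
  -- Subtracting the density makes the row sums of `G` vanish; 2D ≤ N gives 1 - ρ ≥ ρ, so every
  -- entry has absolute value at least ρ.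
  set ρ : ℝ := D / N with hρ
  have hρN : ρ * N = D := div_mul_cancel₀ _ hN'.ne'
  have hρ0 : 0 ≤ ρ := by positivity
  have hρ2 : 2 * ρ ≤ 1 := by
    rw [hρ, ← mul_div_assoc, div_le_one hN']
    exact_mod_cast hDN
  set G : Matrix R C ℝ := Matrix.of fun i j => B i j - ρ with hGdef
  have hBsum : ∀ i, ∑ j, B i j = D := by
    intro i
    rw [← hD i]
    simp [hB, Finset.sum_boole]
  have hBB : ∀ i i', ∑ j, B i j * B i' j = (if i = i' then (D : ℝ) - c else 0) + c := by
    intro i i'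
    by_cases hi : i = i'
    · subst hi
      rw [if_pos rfl, sub_add_cancel, ← hBsum i]
      refine Finset.sum_congr rfl fun j _ => ?_
      by_cases h : S i j = 1 <;> simp [hB, h]
    · rw [if_neg hi, zero_add, ← hc i i' hi, Finset.card_filter]
      push_cast
      refine Finset.sum_congr rfl fun j _ => ?_
      by_cases h : S i j = 1 <;> by_cases h' : S i' j = 1 <;> simp [hB, h, h']
  have hG : ∀ i i', ∑ j, G i j * G i' j
      = (if i = i' then (D : ℝ) - c else 0) + (c - ρ * D) := by
    intro i i'
    have : ∀ j, G i j * G i' j = B i j * B i' j - ρ * B i j - ρ * B i' j + ρ ^ 2 := fun j => by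
      simp only [hGdef, Matrix.of_apply]
      ring
    simp only [this, Finset.sum_add_distrib, Finset.sum_sub_distrib, ← Finset.mul_sum, hBsum,
      hBB, Finset.sum_const, Finset.card_univ, hC, nsmul_eq_mul]
    rw [← hρN]
    ring
  have hβ : (c : ℝ) - ρ * D ≤ 0 := by
    rw [sub_nonpos, hρ, div_mul_eq_mul_div, le_div_iff₀ hN', ← sq]
    exact_mod_cast hcN
  have hα : (0 : ℝ) ≤ D - c := sub_nonneg.2 (Nat.cast_le.2 hcD)
  have key : ∀ δ : ℝ, 0 < δ → ρ * ((N - δ) * N) ≤ M.rank * (N * √((D : ℝ) - c)) := by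
    intro δ hδ
    obtain ⟨u, w, hu, hw, hpos, hsum⟩ := exists_forster
      (EuclideanSpace.basisFun (Fin M.rank) ℝ) hk x y (fun i j => hxy i j ▸ hMne i j) hδ
    have hub := bilinear_le_of_gram hα hβ hG hu hw
    have hlb : ∀ i j, ρ * |⟪u i, w j⟫| ≤ G i j * ⟪u i, w j⟫ := by
      intro i j
      have hp := hpos i j
      rw [hxy] at hp
      have hs := hM i j
      rcases Int.units_eq_one_or (S i j) with h | h
      · have hMpos : 0 < M i j := by
          rcases (hMne i j).lt_or_gt with h' | h'
          · rw [Real.sign_of_neg h', h] at hs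
            norm_num at hs
          · exact h'
        have hupos : 0 < ⟪u i, w j⟫ := pos_of_mul_pos_left hp hMpos.le
        rw [abs_of_pos hupos]
        simp only [hGdef, hB, Matrix.of_apply, h, if_true]
        exact mul_le_mul_of_nonneg_right (by linarith) hupos.le
      · have hMneg : M i j < 0 := by
          rcases (hMne i j).lt_or_gt with h' | h'
          · exact h'
          · rw [Real.sign_of_pos h', h] at hs
            norm_num at hs
        have huneg : ⟪u i, w j⟫ < 0 := by
          by_contra hcon
          exact absurd hp (not_lt.2 (mul_nonpos_of_nonneg_of_nonpos (not_lt.1 hcon) hMneg.le))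
        rw [abs_of_neg huneg]
        simp [hGdef, hB, h]
    have hlb' : ρ * ∑ i, ∑ j, |⟪u i, w j⟫| ≤ ∑ i, ∑ j, G i j * ⟪u i, w j⟫ := by
      simp only [Finset.mul_sum]
      exact Finset.sum_le_sum fun i _ => Finset.sum_le_sum fun j _ => hlb i j
    rw [hR, hC] at hub hsum
    rw [Real.sqrt_mul (by positivity), Real.sqrt_mul_self hN'.le] at hub
    calc ρ * ((N - δ) * N) ≤ ρ * (M.rank * ∑ i, ∑ j, |⟪u i, w j⟫|) := by gcongr
      _ = M.rank * (ρ * ∑ i, ∑ j, |⟪u i, w j⟫|) := by ring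
      _ ≤ _ := mul_le_mul_of_nonneg_left (hlb'.trans hub) (Nat.cast_nonneg _)
  have hlim : (D : ℝ) * N ≤ M.rank * (N * √((D : ℝ) - c)) := by
    refine le_of_forall_pos_sub_le fun ε hε => ?_
    have hD0 : (0 : ℝ) ≤ D := Nat.cast_nonneg D
    have h1 := key (ε / (D + 1)) (by positivity)
    have h2 : ρ * ((N - ε / (D + 1)) * N) = D * N - D * (ε / (D + 1)) := by
      rw [← hρN]; ring
    have h3 : D * (ε / (D + 1)) ≤ ε := by
      rw [← mul_div_assoc, div_le_iff₀ (by positivity)]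
      nlinarith
    linarith
  refine le_of_mul_le_mul_right ?_ hN'
  linarith

end SignMatrix

/-! ### Arithmetic of the point counts and the conclusion -/

namespace IsProjectiveSpace

theorem cast_flatCard {n : ℕ} (hn : 2 ≤ n) (r : ℕ) :
    (flatCard n r : ℝ) = ((n : ℝ) ^ r - 1) / ((n : ℝ) - 1) := by
  have : (n : ℝ) ≠ 1 := by
    have : (2 : ℝ) ≤ n := by exact_mod_cast hn
    linarith
  rw [flatCard, Nat.cast_sum, ← geom_sum_eq this]
  simp

theorem rpow_half_eq_sqrt_pow (n e : ℕ) :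
    (n : ℝ) ^ (((e + 1 + 1 : ℕ) - 1 : ℝ) / 2) = √((n : ℝ) ^ (e + 1)) := by
  rw [Real.sqrt_eq_rpow, ← Real.rpow_natCast, ← Real.rpow_mul (Nat.cast_nonneg n)]
  congr 1
  push_cast
  ring

/-- This makes the sign-rank bound strict: squaring an equality gives n ∣ D², while D ≡ 1 mod n. -/
theorem flatCard_ne_mul_sqrt {n : ℕ} (hn : 2 ≤ n) (e k : ℕ) :
    (flatCard n (e + 2) : ℝ) ≠ k * √((n : ℝ) ^ (e + 1)) := by
  intro h
  have h1 : (flatCard n (e + 2)) ^ 2 = k ^ 2 * n ^ (e + 1) := by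
    have h2 : (flatCard n (e + 2) : ℝ) ^ 2 = k ^ 2 * n ^ (e + 1) := by
      rw [h, mul_pow, Real.sq_sqrt (by positivity)]
    exact_mod_cast h2
  have h2 : n ∣ (flatCard n (e + 2)) ^ 2 :=
    h1 ▸ Dvd.dvd.mul_left (dvd_pow_self n (Nat.succ_ne_zero e)) _
  have h3 : Nat.Coprime n (flatCard n (e + 2)) := by
    rw [flatCard_succ]
    simp
  have h4 := Nat.eq_one_of_dvd_coprimes (h3.pow_right 2) dvd_rfl h2
  omega

/-- With d = e + 1 and a = e/(2(e+1)), the factor n^(e/2) equals (n^(e+1))^a. It then suffices to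
combine N·n^(e+1) ≤ (nD)² with (nD)^e ≤ D^(e+1). The first uses N = nD + 1 = D + n^(e+1) and D ≥ 2,
the second n^e ≤ D. -/
theorem flatCard_succ_rpow_le {n d : ℕ} (hn : 2 ≤ n) (hd : 2 ≤ d) :
    (flatCard n (d + 1) : ℝ) ^ ((1 : ℝ) / 2 - 1 / (2 * (d : ℝ)))
      ≤ flatCard n d / (n : ℝ) ^ (((d : ℝ) - 1) / 2) := by
  obtain ⟨e, rfl⟩ : ∃ e, d = e + 1 := ⟨d - 1, by omega⟩
  set D := flatCard n (e + 1) with hD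
  have hpow : n ^ e ≤ D := by
    rw [hD, flatCard_succ']
    exact Nat.le_add_left _ _
  have hD2 : 2 ≤ D := (hn.trans (Nat.le_self_pow (by omega) n)).trans hpow
  have hN : flatCard n (e + 1 + 1) * n ^ (e + 1) ≤ (n * D) ^ 2 := by
    have h1 : flatCard n (e + 1 + 1) = n * D + 1 := flatCard_succ n (e + 1)
    have h2 : n * D + 1 = D + n ^ (e + 1) := h1.symm.trans (flatCard_succ' n (e + 1))
    rw [h1]
    zify at *
    have h3 : (n : ℤ) ^ (e + 1) = n * D + 1 - D := by linarith
    rw [h3]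
    nlinarith [mul_nonneg (mul_nonneg (show (0 : ℤ) ≤ n by omega) (show (0 : ℤ) ≤ D by omega))
      (show (0 : ℤ) ≤ D - 2 by omega)]
  have hnD : (n * D) ^ e ≤ D ^ (e + 1) := by
    rw [mul_pow, pow_succ, mul_comm]
    exact Nat.mul_le_mul_left _ hpow
  have hn0 : (0 : ℝ) < n := by positivity
  have he : ((e : ℝ) + 1) ≠ 0 := by positivity
  set a : ℝ := 1 / 2 - 1 / (2 * ((e + 1 : ℕ) : ℝ)) with ha
  have ha' : a = e / (2 * (e + 1)) := by
    rw [ha]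
    push_cast
    field_simp
    ring
  have ha0 : 0 ≤ a := by rw [ha']; positivity
  rw [le_div_iff₀ (by positivity)]
  calc (flatCard n (e + 1 + 1) : ℝ) ^ a * (n : ℝ) ^ ((((e + 1 : ℕ) : ℝ) - 1) / 2)
      = ((flatCard n (e + 1 + 1) * n ^ (e + 1) : ℕ) : ℝ) ^ a := by
        rw [Nat.cast_mul, Real.mul_rpow (by positivity) (by positivity), Nat.cast_pow,
          ← Real.rpow_natCast, ← Real.rpow_mul hn0.le]
        congr 2
        rw [ha']
        push_cast
        field_simp
        ring
    _ ≤ (((n * D) ^ 2 : ℕ) : ℝ) ^ a := by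
        gcongr
    _ = (((n * D) ^ e : ℕ) : ℝ) ^ (1 / ((e : ℝ) + 1)) := by
        rw [Nat.cast_pow, Nat.cast_pow, ← Real.rpow_natCast, ← Real.rpow_natCast,
          ← Real.rpow_mul (by positivity), ← Real.rpow_mul (by positivity), ha']
        congr 1
        push_cast
        field_simp
    _ ≤ ((D ^ (e + 1) : ℕ) : ℝ) ^ (1 / ((e : ℝ) + 1)) := by
        gcongr
    _ = D := by
        rw [Nat.cast_pow, ← Real.rpow_natCast, ← Real.rpow_mul (by positivity)]
        push_cast
        rw [mul_one_div_cancel he, Real.rpow_one]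

theorem flatCard_lt_signRank {P L : Type*} [Membership P L] [Fintype P]
    (h : IsProjectiveSpace P L) {n e : ℕ} (hn : 2 ≤ n) (hord : HasOrder P L n)
    (hdim : HasDimension P L (e + 2)) :
    (flatCard n (e + 2) : ℝ)
      < SignMatrix.signRank (signedIncidence P L) * √((n : ℝ) ^ (e + 1)) := by
  classical
  have hn0 : 0 < n := by omega
  have hP := h.card_points hord hdim
  have : Nonempty P := Fintype.card_pos_iff.1 (by rw [hP, flatCard_succ]; omega)
  have hsub : (flatCard n (e + 2) : ℝ) - flatCard n (e + 1) = (n : ℝ) ^ (e + 1) := by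
    rw [flatCard_succ' n (e + 1)]
    push_cast
    ring
  have hle := SignMatrix.le_signRank_mul_sqrt (signedIncidence P L) hP
    (h.card_hyperplane hn0 hord hdim) (D := flatCard n (e + 2)) (c := flatCard n (e + 1))
    (fun p => by
      simp only [signedIncidence_eq_one]
      exact h.card_hyperplane_mem hn0 hord hdim p)
    (fun p q hpq => by
      simp only [signedIncidence_eq_one]
      exact h.card_hyperplane_mem_mem hn0 hord hdim hpq)
    ((flatCard_strictMono hn0).monotone (by omega))
    (by
      rw [flatCard_succ n (e + 2)]
      nlinarith)
    (by
      rw [flatCard_succ n (e + 2), flatCard_succ n (e + 1)]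
      nlinarith [Nat.zero_le (flatCard n (e + 1)), Nat.mul_le_mul_right (flatCard n (e + 1)) hn])
  rw [hsub] at hle
  exact lt_of_le_of_ne hle (flatCard_ne_mul_sqrt hn e _)

end IsProjectiveSpace

theorem theorem6 {P L : Type*} [Membership P L] [Fintype P]
    (hPL : IsProjectiveSpace P L) (d n : ℕ) (hd : 2 ≤ d) (hn : 3 ≤ n)
    (hdim : IsProjectiveSpace.HasDimension P L d) (hord : IsProjectiveSpace.HasOrder P L n) :
    (Fintype.card P : ℝ) = ((n : ℝ) ^ (d + 1) - 1) / ((n : ℝ) - 1) ∧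
    (Fintype.card (IsProjectiveSpace.Hyperplane P L) : ℝ)
      = ((n : ℝ) ^ (d + 1) - 1) / ((n : ℝ) - 1) ∧
    SignMatrix.vcDim (IsProjectiveSpace.signedIncidence P L) = d ∧
    ((n : ℝ) ^ d - 1) / ((n : ℝ) ^ (((d : ℝ) - 1) / 2) * ((n : ℝ) - 1))
      < (SignMatrix.signRank (IsProjectiveSpace.signedIncidence P L) : ℝ) ∧
    (((n : ℝ) ^ (d + 1) - 1) / ((n : ℝ) - 1)) ^ ((1 : ℝ) / 2 - 1 / (2 * (d : ℝ)))
      ≤ ((n : ℝ) ^ d - 1) / ((n : ℝ) ^ (((d : ℝ) - 1) / 2) * ((n : ℝ) - 1)) := by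
  have hn2 : 2 ≤ n := by omega
  have hn0 : 0 < n := by omega
  have hquot : ((n : ℝ) ^ d - 1) / ((n : ℝ) ^ (((d : ℝ) - 1) / 2) * ((n : ℝ) - 1))
      = IsProjectiveSpace.flatCard n d / (n : ℝ) ^ (((d : ℝ) - 1) / 2) := by
    rw [IsProjectiveSpace.cast_flatCard hn2, div_div, mul_comm]
  rw [hquot, ← IsProjectiveSpace.cast_flatCard hn2]
  refine ⟨by rw [hPL.card_points hord hdim], by rw [hPL.card_hyperplane hn0 hord hdim],
    hPL.vcDim_signedIncidence hn0 hord hdim, ?_,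
    IsProjectiveSpace.flatCard_succ_rpow_le hn2 hd⟩
  obtain ⟨e, rfl⟩ : ∃ e, d = e + 1 + 1 := ⟨d - 2, by omega⟩
  rw [IsProjectiveSpace.rpow_half_eq_sqrt_pow, div_lt_iff₀ (by positivity)]
  exact hPL.flatCard_lt_signRank hn2 hord hdim
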